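/- Let $\mathbb H$ be the upper half-plane, $q=e^{2\pi i z}$, $\Delta(z)=q\prod_{n\ge 1}(1-q^n)^{24}$, $E_2(z)=1-24\sum_{n\ge1}\sigma_1(n)q^n$, $E_2^*(z)=E_2(z)-\dfrac{3}{\pi\,\mathrm{Im}\, z}$ and $E_4(z)=\dfrac12\sum_{c,d\in\mathbb Z,\ (c,d)=1}(cz+d)^{-4}$. Let $M_k$ be the space of holomorphic modular forms of weight $k$ for $\mathrm{SL}(2,\mathbb Z)$. For $z_0\in\mathbb H$ with imaginary part $\beta$ put $\sigma_{z_0}=\dfrac{1}{2i\beta}\begin{pmatrix}-\overline{z_0}&z_0\\-1&1\end{pmatrix}$, which maps the open unit disc onto $\mathbb H$ and $0$ to $z_0$. For an even weight $k$ and a holomorphic $f:\mathbb H\to\mathbb C$, the $n$-th Fourier coefficient $c_{z_0}(f,n)$ of $f$ at $z_0$ is the $n$-th Taylor coefficient at $w=0$ of $$(f|_k\sigma_{z_0})(w)=\frac{\det(\sigma_{z_0})^{k/2}\,f(\sigma_{z_0}w)}{j(\sigma_{z_0},w)^{k}},\qquad j\left(\begin{pmatrix}a&b\\c&d\end{pmatrix},w\right)=cw+d,$$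 that is, $(f|_k\sigma_{z_0})(w)=\sum_{n\ge0}c_{z_0}(f,n)w^n$ for $|w|<1$. For $f=\Delta$ the weight is $k=12$. Define functions $\mathcal B_n$ on $\mathbb H$ by $$\mathcal B_0=1,\qquad \mathcal B_1=0,\qquad \mathcal B_{n+1}=12\,\vartheta\mathcal B_n-n(n+11)E_4\mathcal B_{n-1}\quad(n\ge1),$$ where $\vartheta$ is the Serre derivative for the weight $2n$ of $\mathcal B_n$, i.e. $\vartheta\mathcal B_n=\dfrac{1}{2\pi i}\dfrac{d\mathcal B_n}{dz}-\dfrac{2n}{12}E_2\mathcal B_n$. **Theorem 4.1.** For every $r\ge0$ we have $\mathcal B_r\in M_{2r}$, and for every $z\in\mathbb H$ and every integer $m\ge0$, $$c_z(\Delta,m)=\Delta(z)\left(\frac{\pi i}{6}\right)^m(z-\overline z)^{m+6}\sum_{r=0}^m\frac1{r!}\binom{m+11}{r+11}\,E_2^*(z)^{m-r}\,\mathcal B_r(z).$$ -/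

import Mathlib

open UpperHalfPlane ModularForm
open scoped Real MatrixGroups Manifold

noncomputable section

namespace DeltaTaylor

/-- The automorphy factor `j(γ, w) = c w + d` of a complex `2 × 2` matrix. -/
def autFactor (γ : Matrix (Fin 2) (Fin 2) ℂ) (w : ℂ) : ℂ := γ 1 0 * w + γ 1 1

/-- The fractional linear action `γ w = (a w + b) / (c w + d)` of a complex `2 × 2` matrix. -/
def moebius (γ : Matrix (Fin 2) (Fin 2) ℂ) (w : ℂ) : ℂ :=
  (γ 0 0 * w + γ 0 1) / autFactor γ w

/-- The stroke operator `(f|_k γ)(w) = det(γ)^(k/2) f(γ w) / j(γ, w)^k`, for `f` a function on the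
upper half-plane, `k` an even weight, and `γ` a complex matrix. It is meaningful at
those `w` with `γ w` in the upper half-plane (`ofComplex` is the identity there). -/
def stroke (k : ℕ) (f : ℍ → ℂ) (γ : Matrix (Fin 2) (Fin 2) ℂ) (w : ℂ) : ℂ :=
  γ.det ^ (k / 2) * f (ofComplex (moebius γ w)) / autFactor γ w ^ k

/-- The matrix `σ_{z₀} = (1 / (2 i β)) * [[-conj z₀, z₀], [-1, 1]]`, where `β = Im z₀`. -/
def sigmaMatrix (z₀ : ℍ) : Matrix (Fin 2) (Fin 2) ℂ :=
  (1 / (2 * Complex.I * (z₀.im : ℂ))) •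
    !![-(starRingEnd ℂ (z₀ : ℂ)), (z₀ : ℂ); -1, 1]

/-- The `n`-th Fourier coefficient `c_{z₀}(f, n)` of `f` (of even weight `k`) at `z₀`: the `n`-th
coefficient of the Taylor expansion of `f|_k σ_{z₀}` at `0`. -/
def fourierCoeffAt (k : ℕ) (f : ℍ → ℂ) (z₀ : ℍ) (n : ℕ) : ℂ :=
  iteratedDeriv n (stroke k f (sigmaMatrix z₀)) 0 / (n.factorial : ℂ)

/-- The non-holomorphic Eisenstein series `E₂*(z) = E₂(z) - 3 / (π y)`, `y = Im z`. -/
def E2star (z : ℍ) : ℂ := EisensteinSeries.E2 z - 3 / ((π : ℂ) * (z.im : ℂ))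

/-- The functions `𝓑ₙ`: `𝓑₀ = 1`, `𝓑₁ = 0` and, for `n ≥ 1`,
`𝓑ₙ₊₁ = 12 ϑ 𝓑ₙ - n (n + 11) E₄ 𝓑ₙ₋₁`, where `ϑ` is the Serre derivative in weight `2 n`
(the weight of `𝓑ₙ`). In the code the recursion is shifted, `n` there being `n + 1` here. -/
def calB : ℕ → ℍ → ℂ
  | 0 => fun _ => 1
  | 1 => fun _ => 0
  | n + 2 => fun z =>
      12 * Derivative.serreDerivative ((2 * (n + 1) : ℕ) : ℂ) (calB (n + 1)) z
        - ((n + 1 : ℕ) : ℂ) * ((n + 1 + 11 : ℕ) : ℂ) * E₄ z * calB n z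

/-- The recursion in unshifted form. -/
theorem calB_succ (n : ℕ) (hn : 1 ≤ n) (z : ℍ) :
    calB (n + 1) z = 12 * Derivative.serreDerivative (2 * n : ℂ) (calB n) z
      - (n : ℂ) * (n + 11 : ℂ) * E₄ z * calB (n - 1) z := by
  obtain ⟨m, rfl⟩ : ∃ m, n = m + 1 := ⟨n - 1, by omega⟩
  simp [calB]

theorem moebius_sigma (z₀ : ℍ) (w : ℂ) :
    moebius (sigmaMatrix z₀) w = ((z₀ : ℂ) - starRingEnd ℂ (z₀ : ℂ) * w) / (1 - w) := by
  have h : (1 / (2 * Complex.I * (z₀.im : ℂ))) ≠ 0 := by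
    have := z₀.im_ne_zero
    simp [this]
  simp only [moebius, autFactor, sigmaMatrix, Matrix.smul_apply, Matrix.of_apply,
    Matrix.cons_val_zero, Matrix.cons_val_one, Matrix.cons_val_fin_one, Matrix.cons_val',
    smul_eq_mul]
  rw [← mul_div_mul_left ((z₀ : ℂ) - _) (1 - w) h]
  congr 1 <;> ring

/-- `σ_{z₀}` maps the open unit disc into the upper half-plane. -/
theorem moebius_sigma_im_pos (z₀ : ℍ) (w : ℂ) (hw : w ∈ Metric.ball (0 : ℂ) 1) :
    0 < (moebius (sigmaMatrix z₀) w).im := by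
  have hw1 : ‖w‖ < 1 := by simpa using hw
  have hsq : Complex.normSq w < 1 := by
    rw [Complex.normSq_eq_norm_sq]; nlinarith [norm_nonneg w]
  have hne : (1 - w) ≠ 0 := by
    intro h
    have : w = 1 := (sub_eq_zero.mp h).symm
    simp [this] at hw1
  have hpos : 0 < Complex.normSq (1 - w) := Complex.normSq_pos.mpr hne
  have hy : 0 < (z₀ : ℂ).im := z₀.im_pos
  rw [moebius_sigma, Complex.div_im, ← sub_div]
  refine div_pos ?_ hpos
  have key : ((z₀ : ℂ) - starRingEnd ℂ (z₀ : ℂ) * w).im * (1 - w).re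
      - ((z₀ : ℂ) - starRingEnd ℂ (z₀ : ℂ) * w).re * (1 - w).im
      = (z₀ : ℂ).im * (1 - Complex.normSq w) := by
    simp only [Complex.normSq_apply, Complex.sub_im, Complex.sub_re, Complex.mul_im,
      Complex.mul_re, Complex.conj_re, Complex.conj_im, Complex.one_re, Complex.one_im]
    ring
  rw [key]
  exact mul_pos hy (by linarith)

/-- The numbers `c_{z₀}(f, n)` are the coefficients of the expansion of `f|_k σ_{z₀}`, which is
valid on the whole open unit disc when `f` is holomorphic. -/
theorem hasSum_fourierCoeffAt (k : ℕ) (f : ℍ → ℂ) (hf : MDiff f) (z₀ : ℍ) (w : ℂ)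
    (hw : w ∈ Metric.ball (0 : ℂ) 1) :
    HasSum (fun n : ℕ => fourierCoeffAt k f z₀ n * w ^ n) (stroke k f (sigmaMatrix z₀) w) := by
  have h0 : (1 / (2 * Complex.I * (z₀.im : ℂ))) ≠ 0 := by
    have := z₀.im_ne_zero
    simp [this]
  have hne : ∀ v ∈ Metric.ball (0 : ℂ) 1, (1 - v) ≠ 0 := by
    intro v hv h
    have : v = 1 := (sub_eq_zero.mp h).symm
    simp [this] at hv
  have hj : ∀ v, autFactor (sigmaMatrix z₀) v =
      (1 / (2 * Complex.I * (z₀.im : ℂ))) * (1 - v) := by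
    intro v
    simp only [autFactor, sigmaMatrix, Matrix.smul_apply, Matrix.of_apply,
      Matrix.cons_val_zero, Matrix.cons_val_one, Matrix.cons_val_fin_one, Matrix.cons_val',
      smul_eq_mul]
    ring
  have hm : DifferentiableOn ℂ (moebius (sigmaMatrix z₀)) (Metric.ball 0 1) := by
    have : moebius (sigmaMatrix z₀) =
        fun v => ((z₀ : ℂ) - starRingEnd ℂ (z₀ : ℂ) * v) / (1 - v) :=
      funext (moebius_sigma z₀)
    rw [this]
    exact DifferentiableOn.div (by fun_prop) (by fun_prop) hne
  have hd : DifferentiableOn ℂ (stroke k f (sigmaMatrix z₀)) (Metric.ball 0 1) := by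
    unfold stroke
    refine DifferentiableOn.div (DifferentiableOn.const_mul ?_ _) ?_ ?_
    · exact (UpperHalfPlane.mdifferentiable_iff.mp hf).comp hm
        (fun v hv => moebius_sigma_im_pos z₀ v hv)
    · simp only [hj]; fun_prop
    · intro v hv
      rw [hj]
      exact pow_ne_zero _ (mul_ne_zero h0 (hne v hv))
  convert! Complex.hasSum_taylorSeries_on_ball hd hw using 1
  funext n
  simp only [fourierCoeffAt, sub_zero, smul_eq_mul]
  ring

end DeltaTaylor

end

noncomputable section

namespace DeltaTaylor

open Derivative Filter Topology Function

/-! Put h = z - conj z and c = πi h/6, and pull everything back to the disc by w ↦ σ_z w. With Φ =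
Δ|σ_z, X = c E₂(σw)/(1-w)² + 1/(1-w), e = c² E₄(σw)/(1-w)⁴ and b_r = c^r 𝓑_r(σw)/(1-w)^(2r), the
identity DΔ = E₂Δ becomes Φ' = 12XΦ, Ramanujan's DE₂ = (E₂² - E₄)/12 becomes X' = X² - e, and the
recursion for 𝓑 becomes a formula for b_r'. Induction then writes every derivative of Φ as Φ times a
polynomial in X and the b_r (`iteratedDeriv_eq_of_hasDerivAt`). At w = 0 the term 1/(1-w) completes
E₂ to E₂*, since X(0) = cE₂ + 1 = cE₂*.

Modularity of 𝓑_r follows from that of Serre derivatives. Ramanujan's identity holds because there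
are no nonzero cusp forms of weight 4. -/

/-! ### Behaviour at i∞ -/

/-- A function on `ℍ` with a convergent `q`-expansion tends at `i∞` to its constant term. -/
theorem tendsto_atImInfty_of_hasSum_qExpansion {f : ℍ → ℂ} {c : ℕ → ℂ}
    (hf : ∀ τ : ℍ, HasSum (fun m : ℕ => c m • Periodic.qParam 1 τ ^ m) (f τ)) :
    Tendsto f atImInfty (𝓝 (c 0)) := by
  have hq (τ : ℍ) : Periodic.qParam 1 (τ : ℂ) ≠ 0 := Periodic.qParam_ne_zero _
  -- (f - c₀)/q is again a power series in q, hence bounded, so f - c₀ is q times a bounded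
  -- function.
  have hshift (τ : ℍ) : HasSum (fun m : ℕ => c (m + 1) • Periodic.qParam 1 τ ^ m)
      ((f τ - c 0) / Periodic.qParam 1 τ) := by
    have h := ((hasSum_nat_add_iff' 1).mpr (hf τ)).div_const (Periodic.qParam 1 (τ : ℂ))
    convert! h using 1
    · funext m
      rw [eq_div_iff (hq τ), smul_eq_mul, smul_eq_mul, mul_assoc, ← pow_succ]
    · simp
  have hb := isBoundedAtImInfty_of_hasSum_qExpansion one_pos hshift
  have hz : Tendsto (fun τ : ℍ => Periodic.qParam 1 τ * ((f τ - c 0) / Periodic.qParam 1 τ))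
      atImInfty (𝓝 0) :=
    (show ZeroAtFilter atImInfty (fun τ : ℍ => Periodic.qParam 1 τ) from
      qParam_tendsto_atImInfty one_pos).mul_boundedAtFilter hb
  have := hz.add_const (c 0)
  rw [zero_add] at this
  refine this.congr fun τ => ?_
  rw [mul_div_cancel₀ _ (hq τ), sub_add_cancel]

theorem tendsto_E2_atImInfty : Tendsto EisensteinSeries.E2 atImInfty (𝓝 1) := by
  have := tendsto_atImInfty_of_hasSum_qExpansion (f := EisensteinSeries.E2)
    (c := fun m => if m = 0 then 1 else -24 * ArithmeticFunction.sigma 1 m) fun τ => by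
      simpa only [Periodic.qParam, Complex.ofReal_one, div_one] using!
        EisensteinSeries.hasSum_qExpansion_E2 (z := τ)
  simpa using this

theorem tendsto_E4_atImInfty : Tendsto E₄ atImInfty (𝓝 1) := by
  have := tendsto_atImInfty_of_hasSum_qExpansion
    (ModularForm.hasSum_qExpansion E₄ one_pos one_mem_strictPeriods_SL)
  rwa [EisensteinSeries.E_qExpansion_coeff_zero _ ⟨2, rfl⟩] at this

/-- The derivative of a holomorphic function that is bounded at `i∞` vanishes at `i∞`. -/
theorem isZeroAtImInfty_normalizedDeriv {f : ℍ → ℂ} (hf : MDiff f) (hb : IsBoundedAtImInfty f) :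
    IsZeroAtImInfty (normalizedDerivOfComplex f) := by
  obtain ⟨M, A, hM⟩ := isBoundedAtImInfty_iff.mp hb
  have hd := UpperHalfPlane.mdifferentiable_iff.mp hf
  -- Cauchy's estimate: high enough in ℍ, discs of any radius R stay in the region where f is
  -- bounded by M.
  have hderiv : ∀ R : ℝ, 0 < R → ∀ z : ℍ, max A 1 + R ≤ z.im →
      ‖deriv (f ∘ ofComplex) z‖ ≤ M / R := by
    intro R hR z hz
    have him : ∀ w ∈ Metric.closedBall (z : ℂ) R, max A 1 ≤ w.im := by
      intro w hw
      have h1 : |(w - z).im| ≤ R :=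
        (Complex.abs_im_le_norm _).trans (by simpa [dist_eq_norm] using hw)
      have h2 := (abs_le.mp h1).1
      rw [Complex.sub_im, coe_im] at h2
      linarith
    have hpos : ∀ w ∈ Metric.closedBall (z : ℂ) R, 0 < w.im := fun w hw =>
      zero_lt_one.trans_le ((le_max_right _ _).trans (him w hw))
    refine Complex.norm_deriv_le_of_forall_mem_sphere_norm_le hR
      ((hd.mono fun w hw => hpos w hw).diffContOnCl_ball subset_rfl) fun w hw => ?_
    have hw' := Metric.sphere_subset_closedBall hw
    rw [Function.comp_apply, ofComplex_apply_of_im_pos (hpos w hw')]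
    exact hM _ ((le_max_left _ _).trans (him w hw'))
  have hpi : ‖(2 * π * Complex.I)⁻¹‖ ≤ 1 := by
    have : 1 ≤ 2 * π := by linarith [Real.pi_gt_three]
    have h : ‖(2 * π * Complex.I : ℂ)‖ = 2 * π := by simp [abs_of_pos Real.pi_pos]
    rw [norm_inv, h]
    exact inv_le_one_of_one_le₀ this
  refine isZeroAtImInfty_iff.mpr fun ε hε => ⟨max A 1 + (|M| + 1) / ε, fun z hz => ?_⟩
  have hR : 0 < (|M| + 1) / ε := by positivity
  have h := hderiv _ hR z hz
  rw [normalizedDerivOfComplex, norm_mul]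
  refine (mul_le_of_le_one_left (norm_nonneg _) hpi).trans (h.trans ?_)
  rw [div_div_eq_mul_div, div_le_iff₀ (by positivity)]
  nlinarith [le_abs_self M]

/-! ### Level-one forms and the modularity of 𝓑_r -/

/-- A holomorphic function on `ℍ` that is slash-invariant under `SL(2, ℤ)` and bounded at `i∞` is
a modular form of level one. -/
def modularFormOfBounded {k : ℤ} (f : ℍ → ℂ) (hf : MDiff f)
    (hslash : ∀ γ : SL(2, ℤ), f ∣[k] γ = f) (hb : IsBoundedAtImInfty f) : ModularForm 𝒮ℒ k where
  toFun := f
  slash_action_eq' A hA := by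
    obtain ⟨A, rfl⟩ := hA
    exact hslash A
  holo' := hf
  bdd_at_cusps' hc := by
    rw [Subgroup.IsArithmetic.isCusp_iff_isCusp_SL2Z] at hc
    rw [OnePoint.isBoundedAt_iff_forall_SL2Z hc]
    intro γ _
    simpa only [hslash] using hb

theorem slash_eq_self {k : ℤ} (f : ModularForm 𝒮ℒ k) (γ : SL(2, ℤ)) : (f : ℍ → ℂ) ∣[k] γ = f :=
  SlashInvariantFormClass.slash_action_eq f _ ⟨γ, rfl⟩

theorem isBoundedAtImInfty_coe {k : ℤ} (f : ModularForm 𝒮ℒ k) : IsBoundedAtImInfty f :=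
  ModularFormClass.bdd_at_infty f

/-- The Serre derivative as a map from modular forms of weight `k` to weight `k + 2`. -/
def serreDerivativeForm {k : ℤ} (f : ModularForm 𝒮ℒ k) : ModularForm 𝒮ℒ (k + 2) :=
  modularFormOfBounded (serreDerivative k f) (serreDerivative_mdifferentiable _ f.holo')
    (fun γ => serreDerivative_slash_invariant f.holo' (slash_eq_self f γ)) <| by
      have h1 := (isZeroAtImInfty_normalizedDeriv f.holo'
        (isBoundedAtImInfty_coe f)).isBoundedAtImInfty
      have h2 := (EisensteinSeries.isBoundedAtImInfty_E2.mul
        (isBoundedAtImInfty_coe f)).const_mul_left ((k : ℂ) * 12⁻¹)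
      refine (h1.sub (h2.congr_left (f₂ := fun z => (k : ℂ) * 12⁻¹ * EisensteinSeries.E2 z * f z)
        fun z => ?_))
      simp [mul_assoc]

/-- The functions `𝓑ᵣ` are modular forms of weight `2 r`. -/
theorem exists_modularForm_calB (r : ℕ) :
    ∃ g : ModularForm 𝒮ℒ ((2 * r : ℕ) : ℤ), (g : ℍ → ℂ) = calB r := by
  induction r using Nat.twoStepInduction with
  | zero => exact ⟨ModularForm.mcast (by simp) (1 : ModularForm 𝒮ℒ 0), rfl⟩
  | one => exact ⟨0, rfl⟩
  | more n ih0 ih1 =>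
    obtain ⟨g0, h0⟩ := ih0
    obtain ⟨g1, h1⟩ := ih1
    refine ⟨ModularForm.mcast (by push_cast; ring) ((12 : ℂ) • serreDerivativeForm g1) -
      ModularForm.mcast (by push_cast; ring)
        ((((n + 1 : ℕ) : ℂ) * ((n + 1 + 11 : ℕ) : ℂ)) • E₄.mul g0), ?_⟩
    funext z
    have e1 : serreDerivativeForm g1 z =
        serreDerivative ((2 * (n + 1) : ℕ) : ℂ) (calB (n + 1)) z := by
      rw [← h1]
      change serreDerivative _ _ z = _
      norm_cast
    change 12 * serreDerivativeForm g1 z -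
      ((n + 1 : ℕ) : ℂ) * ((n + 1 + 11 : ℕ) : ℂ) * (E₄ z * g0 z) = _
    rw [e1, h0, calB]
    ring

theorem mdifferentiable_calB (r : ℕ) : MDiff (calB r) := by
  obtain ⟨g, hg⟩ := exists_modularForm_calB r
  exact hg ▸ g.holo'

/-! ### Ramanujan's identity for E₂ -/

/-- The derivative of `c / (c z + d)`. -/
theorem hasDerivAt_div_denom (γ : SL(2, ℤ)) (z : ℍ) :
    HasDerivAt ((fun τ : ℍ => (γ 1 0 : ℂ) / denom γ τ) ∘ ofComplex)
      (-((γ 1 0 : ℂ) / denom γ z) ^ 2) z := by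
  have hz := denom_ne_zero γ z
  have h := (hasDerivAt_denom_zpow (γ : GL (Fin 2) ℝ) (-1) z).const_mul (γ 1 0 : ℂ)
  have heq : ((fun τ : ℍ => (γ 1 0 : ℂ) / denom γ τ) ∘ ofComplex) =ᶠ[𝓝 (z : ℂ)]
      fun w => (γ 1 0 : ℂ) * denom γ w ^ (-1 : ℤ) := by
    filter_upwards [isOpen_upperHalfPlaneSet.mem_nhds z.im_pos] with w hw
    rw [Function.comp_apply, ofComplex_apply_of_im_pos hw, zpow_neg_one, div_eq_mul_inv]
  refine (h.congr_of_eventuallyEq heq).congr_deriv ?_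
  rw [show (-1 - 1 : ℤ) = -(2 : ℕ) by norm_num, zpow_neg, zpow_natCast]
  simp
  field_simp

/-- `D E₂ - E₂² / 12` transforms as a modular form of weight four. -/
theorem slash_normalizedDeriv_E2 (γ : SL(2, ℤ)) :
    (normalizedDerivOfComplex EisensteinSeries.E2 -
        (1 / 12 : ℂ) • (EisensteinSeries.E2 * EisensteinSeries.E2)) ∣[(4 : ℤ)] γ =
      normalizedDerivOfComplex EisensteinSeries.E2 -
        (1 / 12 : ℂ) • (EisensteinSeries.E2 * EisensteinSeries.E2) := by
  set v : ℍ → ℂ := fun τ => (γ 1 0 : ℂ) / denom γ τ with hv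
  -- The constant is 2πi/(2ζ(2)) = 6i/π.
  have hE : EisensteinSeries.E2 ∣[(2 : ℤ)] γ =
      EisensteinSeries.E2 - (6 * Complex.I / π) • v := by
    rw [EisensteinSeries.E2_slash_action, riemannZeta_two]
    congr 1
    funext τ
    simp only [EisensteinSeries.D2, Pi.smul_apply, smul_eq_mul, hv]
    field_simp
  have hvd : MDiff v := fun τ =>
    mdifferentiableAt_iff.mpr (hasDerivAt_div_denom γ τ).differentiableAt
  have hD := normalizedDerivOfComplex_SL_slash (k := 2) E2_mdifferentiable (γ := γ)
  rw [hE, normalizedDerivOfComplex_sub _ _ E2_mdifferentiable (hvd.const_smul _),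
    normalizedDerivOfComplex_smul _ _ hvd] at hD
  have hsq := ModularForm.mul_slash_SL2 2 2 γ EisensteinSeries.E2 EisensteinSeries.E2
  rw [hE] at hsq
  rw [sub_eq_add_neg, SlashAction.add_slash, SlashAction.neg_slash, ModularForm.SL_smul_slash]
  norm_num at hsq hD
  rw [hsq]
  funext τ
  have hDτ := congrFun hD τ
  have hvτ : normalizedDerivOfComplex v τ = (2 * π * Complex.I)⁻¹ * -(v τ) ^ 2 :=
    congrArg ((2 * π * Complex.I)⁻¹ * ·) (hasDerivAt_div_denom γ τ).deriv
  have hinv : (2 * π * Complex.I : ℂ)⁻¹ = -Complex.I * (π : ℂ)⁻¹ / 2 := by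
    rw [mul_inv, mul_inv, Complex.inv_I]
    ring
  rw [hinv] at hvτ
  simp only [Pi.sub_apply, Pi.add_apply, Pi.neg_apply, Pi.smul_apply, Pi.mul_apply, smul_eq_mul]
    at hDτ ⊢
  rw [← show v τ = _ from rfl] at hDτ
  -- Since v' = -v², the factor 1/12 makes both the E₂v and the v² anomalies cancel.
  linear_combination -hDτ - 6 * Complex.I * (π : ℂ)⁻¹ * hvτ

/-- Ramanujan's identity for the derivative of `E₂`. -/
theorem normalizedDeriv_E2 (z : ℍ) :
    normalizedDerivOfComplex EisensteinSeries.E2 z = (EisensteinSeries.E2 z ^ 2 - E₄ z) / 12 := by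
  set G : ℍ → ℂ := normalizedDerivOfComplex EisensteinSeries.E2 -
    (1 / 12 : ℂ) • (EisensteinSeries.E2 * EisensteinSeries.E2) with hG
  have hmd : MDiff G :=
    (normalizedDerivOfComplex_mdifferentiable E2_mdifferentiable).sub
      ((E2_mdifferentiable.mul E2_mdifferentiable).const_smul _)
  have hlim : Tendsto G atImInfty (𝓝 (0 - (1 / 12 : ℂ) • (1 * 1))) :=
    Tendsto.sub (isZeroAtImInfty_normalizedDeriv E2_mdifferentiable
      EisensteinSeries.isBoundedAtImInfty_E2)
      ((tendsto_E2_atImInfty.mul tendsto_E2_atImInfty).const_smul _)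
  -- The constant terms -1/12 and 1/12 cancel, so g vanishes at i∞.
  let g : ModularForm 𝒮ℒ 4 :=
    modularFormOfBounded G hmd slash_normalizedDeriv_E2 (hlim.isBigO_one ℝ) + (1 / 12 : ℂ) • E₄
  have hzero : IsZeroAtImInfty g := by
    have := hlim.add (tendsto_E4_atImInfty.const_mul (1 / 12))
    rw [show (0 - (1 / 12 : ℂ) • (1 * 1) + 1 / 12 * 1 : ℂ) = 0 by norm_num] at this
    exact this
  let g' : CuspForm 𝒮ℒ 4 :=
    { toSlashInvariantForm := g.toSlashInvariantForm
      holo' := g.holo'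
      zero_at_cusps' := fun hc => by
        rw [Subgroup.IsArithmetic.isCusp_iff_isCusp_SL2Z] at hc
        rw [OnePoint.isZeroAt_iff_forall_SL2Z hc]
        intro γ _
        change IsZeroAtImInfty ((g : ℍ → ℂ) ∣[(4 : ℤ)] γ)
        rwa [slash_eq_self] }
  have h0 : g' = 0 := rank_zero_iff_forall_zero.mp
    (CuspForm.rank_eq_zero_of_weight_lt_twelve (by norm_num)) g'
  have h1 : normalizedDerivOfComplex EisensteinSeries.E2 z -
      1 / 12 * (EisensteinSeries.E2 z * EisensteinSeries.E2 z) + 1 / 12 * E₄ z = 0 :=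
    DFunLike.congr_fun h0 z
  linear_combination h1

/-! ### Coefficients and the abstract differential recursion -/

/-- The coefficients `(n! / r!) * C(n + 11, r + 11)` of the iterated derivatives of `Δ`. -/
def taylorCoeff (n r : ℕ) : ℂ :=
  (n.factorial : ℂ) / (r.factorial : ℂ) * (Nat.choose (n + 11) (r + 11) : ℂ)

theorem taylorCoeff_zero_zero : taylorCoeff 0 0 = 1 := by
  simp only [taylorCoeff, Nat.choose_self, Nat.factorial_zero, Nat.cast_one, div_one, one_mul]

/-- This ratio of neighbouring coefficients is what cancels all terms containing e in
`sum_taylorCoeff_succ`. -/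
theorem taylorCoeff_succ_right (n r : ℕ) :
    taylorCoeff n (r + 1) * ((r + 1) * (r + 12)) = taylorCoeff n r * (n - r) := by
  have h : (Nat.choose (n + 11) (r + 12) : ℂ) * (r + 12) =
      Nat.choose (n + 11) (r + 11) * (n - r) := by
    rcases le_or_gt r n with hr | hr
    · have := Nat.choose_succ_right_eq (n + 11) (r + 11)
      rw [show n + 11 - (r + 11) = n - r by omega] at this
      have := congrArg (Nat.cast : ℕ → ℂ) this
      push_cast [Nat.cast_sub hr] at this
      linear_combination this
    · simp [Nat.choose_eq_zero_of_lt (show n + 11 < r + 11 by omega),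
        Nat.choose_eq_zero_of_lt (show n + 11 < r + 12 by omega)]
  have hr : (r.factorial : ℂ) ≠ 0 := Nat.cast_ne_zero.mpr r.factorial_ne_zero
  have hr' : (r + 1 : ℂ) ≠ 0 := r.cast_add_one_ne_zero
  unfold taylorCoeff
  rw [Nat.factorial_succ]
  push_cast
  field_simp
  rw [show r + 1 + 11 = r + 12 by ring]
  linear_combination (n.factorial : ℂ) * h

/-- Pascal's rule yields a factor n + 1 on `taylorCoeff n r`; splitting it as (r + 1) + (n - r) and
applying `taylorCoeff_succ_right` to the second part gives the claim after division by r + 1. -/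
theorem taylorCoeff_succ_succ (n r : ℕ) :
    taylorCoeff (n + 1) (r + 1) =
      taylorCoeff n (r + 1) * (n + (r + 1) + 12) + taylorCoeff n r := by
  have hr : (r.factorial : ℂ) ≠ 0 := Nat.cast_ne_zero.mpr r.factorial_ne_zero
  have hr' : (r + 1 : ℂ) ≠ 0 := r.cast_add_one_ne_zero
  have h1 := taylorCoeff_succ_right n r
  have h2 : taylorCoeff (n + 1) (r + 1) * (r + 1) =
      (n + 1) * (taylorCoeff n r + (r + 1) * taylorCoeff n (r + 1)) := by
    unfold taylorCoeff
    rw [Nat.factorial_succ, Nat.factorial_succ,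
      show n + 1 + 11 = (n + 11) + 1 by ring, show r + 1 + 11 = (r + 11) + 1 by ring,
      Nat.choose_succ_succ]
    push_cast
    field_simp
  refine mul_right_cancel₀ hr' ?_
  linear_combination h2 - h1

theorem taylorCoeff_succ_zero (n : ℕ) :
    taylorCoeff (n + 1) 0 = taylorCoeff n 0 * (n + 12) := by
  have h := Nat.add_one_mul_choose_eq (n + 11) 11
  have h' := Nat.choose_succ_right_eq (n + 12) 11
  have h2 : (n + 12) * Nat.choose (n + 11) 11 = Nat.choose (n + 12) 11 * (n + 1) := by
    rw [show n + 12 - 11 = n + 1 by omega] at h'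
    rw [← h', ← h]
  have h3 := congrArg (Nat.cast : ℕ → ℂ) h2
  push_cast at h3
  unfold taylorCoeff
  rw [Nat.factorial_succ, show n + 1 + 11 = n + 12 by ring, zero_add]
  push_cast
  linear_combination -(n.factorial : ℂ) / ((0).factorial : ℂ) * h3

theorem taylorCoeff_eq_zero {n r : ℕ} (h : n < r) : taylorCoeff n r = 0 := by
  simp [taylorCoeff, Nat.choose_eq_zero_of_lt (show n + 11 < r + 11 by omega)]

/-- The algebraic recursion behind `iteratedDeriv_eq_of_hasDerivAt`. -/
theorem sum_taylorCoeff_succ (n : ℕ) (X e : ℂ) (b : ℕ → ℂ) :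
    12 * X * ∑ r ∈ Finset.range (n + 1), taylorCoeff n r * (X ^ (n - r) * b r) +
      ∑ r ∈ Finset.range (n + 1), taylorCoeff n r *
        (((n - r : ℕ) : ℂ) * X ^ (n - r - 1) * (X ^ 2 - e) * b r +
          X ^ (n - r) * (b (r + 1) + r * (r + 11) * e * b (r - 1) + 2 * r * X * b r)) =
    ∑ r ∈ Finset.range (n + 2), taylorCoeff (n + 1) r * (X ^ (n + 1 - r) * b r) := by
  have hterm : ∀ r ∈ Finset.range (n + 1),
      12 * X * (taylorCoeff n r * (X ^ (n - r) * b r)) + taylorCoeff n r *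
        (((n - r : ℕ) : ℂ) * X ^ (n - r - 1) * (X ^ 2 - e) * b r +
          X ^ (n - r) * (b (r + 1) + r * (r + 11) * e * b (r - 1) + 2 * r * X * b r)) =
      taylorCoeff n r * (n + r + 12) * (X ^ (n + 1 - r) * b r) +
      taylorCoeff n r * (X ^ (n - r) * b (r + 1)) +
      (taylorCoeff n r * (r * (r + 11)) * (X ^ (n - r) * b (r - 1)) -
        taylorCoeff n r * (n - r) * (X ^ (n - r - 1) * b r)) * e := by
    intro r hr
    have hrn : r ≤ n := Nat.lt_succ_iff.mp (Finset.mem_range.mp hr)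
    obtain ⟨d, rfl⟩ := Nat.exists_eq_add_of_le hrn
    -- For r = n the exponent n - r - 1 truncates to 0, but its factor n - r vanishes.
    rcases d with _ | d
    · simp
      ring
    · simp only [show r + (d + 1) - r = d + 1 by omega, show r + (d + 1) + 1 - r = d + 2 by omega,
        Nat.add_sub_cancel]
      push_cast
      ring
  have he : ∑ r ∈ Finset.range (n + 1),
      (taylorCoeff n r * (r * (r + 11)) * (X ^ (n - r) * b (r - 1)) -
        taylorCoeff n r * (n - r) * (X ^ (n - r - 1) * b r)) = 0 := by
    -- The r = 0 term of the first sum and the r = n term of the second vanish; a shift of index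
    -- matches the rest.
    rw [Finset.sum_sub_distrib, Finset.sum_range_succ', Finset.sum_range_succ _ n, sub_eq_zero]
    simp only [Nat.cast_zero, zero_mul, mul_zero, add_zero, sub_self, Nat.add_sub_cancel]
    refine Finset.sum_congr rfl fun r _ => ?_
    rw [Nat.sub_sub]
    push_cast
    linear_combination (X ^ (n - (r + 1)) * b r) * taylorCoeff_succ_right n r
  rw [Finset.mul_sum, ← Finset.sum_add_distrib, Finset.sum_congr rfl hterm,
    Finset.sum_add_distrib, Finset.sum_add_distrib, ← Finset.sum_mul, he, zero_mul, add_zero,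
    Finset.sum_range_succ' _ (n + 1), taylorCoeff_succ_zero]
  have hext : ∑ r ∈ Finset.range (n + 1),
      taylorCoeff n r * (n + r + 12) * (X ^ (n + 1 - r) * b r) =
      ∑ r ∈ Finset.range (n + 2),
        taylorCoeff n r * (n + r + 12) * (X ^ (n + 1 - r) * b r) := by
    rw [Finset.sum_range_succ _ (n + 1), taylorCoeff_eq_zero n.lt_succ_self]
    simp
  rw [hext, Finset.sum_range_succ', add_right_comm, ← Finset.sum_add_distrib]
  congr 1
  · refine Finset.sum_congr rfl fun r _ => ?_
    rw [taylorCoeff_succ_succ, Nat.add_sub_add_right]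
    push_cast
    ring
  · simp

/-- Iterated derivatives of a solution of `Φ' = 12 X Φ`, when `X` satisfies a Riccati equation and
`b` is a sequence of functions with a matching three-term differential recursion. -/
theorem iteratedDeriv_eq_of_hasDerivAt {U : Set ℂ} (hU : IsOpen U) {Φ X e : ℂ → ℂ}
    {b : ℕ → ℂ → ℂ}
    (hΦ : ∀ w ∈ U, HasDerivAt Φ (12 * X w * Φ w) w)
    (hX : ∀ w ∈ U, HasDerivAt X (X w ^ 2 - e w) w)
    (hb : ∀ n, ∀ w ∈ U, HasDerivAt (b n)
      (b (n + 1) w + n * (n + 11) * e w * b (n - 1) w + 2 * n * X w * b n w) w)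
    (hb0 : ∀ w ∈ U, b 0 w = 1) (n : ℕ) :
    ∀ w ∈ U, iteratedDeriv n Φ w =
      Φ w * ∑ r ∈ Finset.range (n + 1), taylorCoeff n r * (X w ^ (n - r) * b r w) := by
  induction n with
  | zero =>
    intro w hw
    rw [iteratedDeriv_zero, Finset.sum_range_one, taylorCoeff_zero_zero, hb0 w hw, Nat.sub_self,
      pow_zero, one_mul, one_mul, mul_one]
  | succ n ih =>
    intro w hw
    have heq : iteratedDeriv n Φ =ᶠ[𝓝 w] fun w => Φ w *
        ∑ r ∈ Finset.range (n + 1), taylorCoeff n r * (X w ^ (n - r) * b r w) := by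
      filter_upwards [hU.mem_nhds hw] with v hv using ih v hv
    have hs := HasDerivAt.fun_sum (u := Finset.range (n + 1)) fun r _ =>
      (((hX w hw).pow (n - r)).mul (hb r w hw)).const_mul (taylorCoeff n r)
    rw [iteratedDeriv_succ, heq.deriv_eq, ← sum_taylorCoeff_succ n (X w) (e w) (b · w)]
    refine (((hΦ w hw).mul hs).congr_deriv ?_).deriv
    simp only [Pi.mul_apply, Pi.pow_apply]
    ring

/-! ### Pullback to the disc -/

/-- The pullback of `f` along the disc parametrization `w ↦ σ_z w`. -/
def pullback (z : ℍ) (f : ℍ → ℂ) (w : ℂ) : ℂ := f (ofComplex (moebius (sigmaMatrix z) w))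

theorem one_sub_ne_zero_of_mem_ball {w : ℂ} (hw : w ∈ Metric.ball (0 : ℂ) 1) : 1 - w ≠ 0 := by
  intro h
  rw [← sub_eq_zero.mp h] at hw
  simp at hw

/-- Chain rule with σ_z'(w) = (z - conj z)/(1-w)²; the 2πi undoes the normalization of D. -/
theorem hasDerivAt_pullback (z : ℍ) {f : ℍ → ℂ} (hf : MDiff f) {w : ℂ}
    (hw : w ∈ Metric.ball (0 : ℂ) 1) :
    HasDerivAt (pullback z f) (2 * π * Complex.I * ((z : ℂ) - starRingEnd ℂ (z : ℂ)) *
      pullback z (normalizedDerivOfComplex f) w / (1 - w) ^ 2) w := by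
  have h1 := one_sub_ne_zero_of_mem_ball hw
  have him := moebius_sigma_im_pos z w hw
  have hm : HasDerivAt (moebius (sigmaMatrix z))
      (((z : ℂ) - starRingEnd ℂ (z : ℂ)) / (1 - w) ^ 2) w := by
    have := (((hasDerivAt_id w).const_mul (starRingEnd ℂ (z : ℂ))).const_sub (z : ℂ)).div
      ((hasDerivAt_id w).const_sub 1) h1
    rw [show moebius (sigmaMatrix z) = _ from funext (moebius_sigma z)]
    refine this.congr_deriv ?_
    simp only [id]
    ring
  have hfd : HasDerivAt (f ∘ ofComplex) (deriv (f ∘ ofComplex) (moebius (sigmaMatrix z) w))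
      (moebius (sigmaMatrix z) w) :=
    ((UpperHalfPlane.mdifferentiable_iff.mp hf).differentiableAt
      (isOpen_upperHalfPlaneSet.mem_nhds him)).hasDerivAt
  refine (hfd.comp w hm).congr_deriv ?_
  rw [pullback, normalizedDerivOfComplex, ofComplex_apply_of_im_pos him]
  have hpi : (2 * π * Complex.I : ℂ) ≠ 0 := Complex.two_pi_I_ne_zero
  change deriv (f ∘ ofComplex) (moebius (sigmaMatrix z) w) * _ = _ * (_ *
    deriv (f ∘ ofComplex) (moebius (sigmaMatrix z) w)) / _
  field_simp

/-- Δ = η²⁴, and the logarithmic derivative of η is (πi/12)E₂. -/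
theorem normalizedDeriv_discriminant (z : ℍ) :
    normalizedDerivOfComplex discriminant z = EisensteinSeries.E2 z * discriminant z := by
  have hd := (differentiableAt_eta_of_mem_upperHalfPlaneSet z.2).hasDerivAt.pow 24
  have heq : discriminant ∘ ofComplex =ᶠ[𝓝 (z : ℂ)] eta ^ 24 := by
    filter_upwards [isOpen_upperHalfPlaneSet.mem_nhds z.im_pos] with w hw
    simp [discriminant, ofComplex_apply_of_im_pos hw]
  have hlog := logDeriv_eta_eq_E2 z
  rw [logDeriv_apply, div_eq_iff (eta_ne_zero z.2)] at hlog
  rw [normalizedDerivOfComplex, heq.deriv_eq, hd.deriv, hlog, discriminant]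
  have hpi : (π : ℂ) ≠ 0 := Complex.ofReal_ne_zero.mpr Real.pi_ne_zero
  field_simp
  norm_num
  ring

/-- With h = z - conj z, det σ_z = 1/h and j = (1-w)/h, leaving h^(12-6). -/
theorem stroke_sigmaMatrix (f : ℍ → ℂ) (z : ℍ) (w : ℂ) :
    stroke 12 f (sigmaMatrix z) w =
      ((z : ℂ) - starRingEnd ℂ (z : ℂ)) ^ 6 * (pullback z f w / (1 - w) ^ 12) := by
  have hz : (z : ℂ) - starRingEnd ℂ (z : ℂ) = 2 * Complex.I * z.im := by
    rw [Complex.sub_conj, coe_im]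
    push_cast
    ring
  have h0 : (2 * Complex.I * z.im : ℂ) ≠ 0 := by simp [z.im_ne_zero]
  have hj : autFactor (sigmaMatrix z) w = (1 - w) / (2 * Complex.I * z.im) := by
    change 1 / (2 * Complex.I * (z.im : ℂ)) * -1 * w + 1 / (2 * Complex.I * (z.im : ℂ)) * 1 = _
    ring
  have hdet : (sigmaMatrix z).det = 1 / (2 * Complex.I * z.im) := by
    rw [sigmaMatrix, Matrix.det_smul, Matrix.det_fin_two_of, Fintype.card_fin]
    rw [show -(starRingEnd ℂ (z : ℂ)) * 1 - (z : ℂ) * -1 = 2 * Complex.I * z.im by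
      rw [← hz]; ring]
    field_simp
  rw [stroke, hj, hdet, hz, pullback]
  generalize (2 * Complex.I * z.im : ℂ) = t at *
  rw [div_pow, div_pow, one_pow, div_div_eq_mul_div, show 12 / 2 = 6 by norm_num]
  field_simp

/-- The `m`-th coefficient of `Δ` at `z` in terms of `E₂*` and the `𝓑ᵣ`. -/
theorem fourierCoeffAt_discriminant (z : ℍ) (m : ℕ) :
    fourierCoeffAt 12 discriminant z m =
      discriminant z * ((π : ℂ) * Complex.I / 6) ^ m *
        ((z : ℂ) - starRingEnd ℂ (z : ℂ)) ^ (m + 6) *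
        ∑ r ∈ Finset.range (m + 1),
          (1 / (r.factorial : ℂ)) * (Nat.choose (m + 11) (r + 11) : ℂ) *
            E2star z ^ (m - r) * calB r z := by
  set h : ℂ := (z : ℂ) - starRingEnd ℂ (z : ℂ) with hh
  -- Chosen so that 2πi h = 12c, the factor produced by `hasDerivAt_pullback`.
  set c : ℂ := π * Complex.I / 6 * h with hc
  have hmd : MDiff discriminant := CuspForm.discriminant.holo'
  have hinv (w : ℂ) (hw : w ∈ Metric.ball (0 : ℂ) 1) (k : ℕ) :
      HasDerivAt (fun w => ((1 - w) ^ k)⁻¹) (k * ((1 - w) ^ (k + 1))⁻¹) w := by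
    have h1 := one_sub_ne_zero_of_mem_ball hw
    have := (((hasDerivAt_id w).const_sub 1).pow k).inv (pow_ne_zero k h1)
    refine this.congr_deriv ?_
    rcases k with _ | k
    · simp
    · simp only [id, Nat.add_sub_cancel, Pi.pow_apply]
      field_simp
      ring
  have hderiv {f : ℍ → ℂ} (hf : MDiff f) (k : ℕ) (w : ℂ) (hw : w ∈ Metric.ball (0 : ℂ) 1) :
      HasDerivAt (fun w => pullback z f w * ((1 - w) ^ k)⁻¹)
        (12 * c * pullback z (normalizedDerivOfComplex f) w * ((1 - w) ^ (k + 2))⁻¹ +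
          k * pullback z f w * ((1 - w) ^ (k + 1))⁻¹) w := by
    have h1 := one_sub_ne_zero_of_mem_ball hw
    refine ((hasDerivAt_pullback z hf hw).mul (hinv w hw k)).congr_deriv ?_
    rw [hc, ← hh]
    field_simp
    ring
  let X : ℂ → ℂ := fun w => c * (pullback z EisensteinSeries.E2 w * ((1 - w) ^ 2)⁻¹) +
    ((1 - w) ^ 1)⁻¹
  let e : ℂ → ℂ := fun w => c ^ 2 * (pullback z E₄ w * ((1 - w) ^ 4)⁻¹)
  let b : ℕ → ℂ → ℂ := fun r w => c ^ r * (pullback z (calB r) w * ((1 - w) ^ (2 * r))⁻¹)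
  have key := iteratedDeriv_eq_of_hasDerivAt (U := Metric.ball 0 1) Metric.isOpen_ball
    (Φ := stroke 12 discriminant (sigmaMatrix z)) (X := X) (e := e) (b := b) ?_ ?_ ?_ ?_ m 0
    (Metric.mem_ball_self one_pos)
  · have hp0 (f : ℍ → ℂ) : pullback z f 0 = f z := by
      rw [pullback, moebius_sigma, mul_zero, sub_zero, sub_zero, div_one, ofComplex_apply]
    have hX0 : X 0 = c * E2star z := by
      have hy : (z.im : ℂ) ≠ 0 := Complex.ofReal_ne_zero.mpr z.im_ne_zero
      have hpi : (π : ℂ) ≠ 0 := Complex.ofReal_ne_zero.mpr Real.pi_ne_zero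
      have hz : h = 2 * Complex.I * z.im := by
        rw [hh, Complex.sub_conj, coe_im]
        push_cast
        ring
      -- As h = 2iy, c = -πy/3.
      have hcy : c * (3 / (π * z.im)) = -1 := by
        rw [hc, hz]
        field_simp
        linear_combination 6 * Complex.I_sq
      simp only [X, E2star, hp0, mul_sub, hcy, sub_zero, one_pow, inv_one, mul_one]
      ring
    have hm : (m.factorial : ℂ) ≠ 0 := Nat.cast_ne_zero.mpr m.factorial_ne_zero
    rw [fourierCoeffAt, key, stroke_sigmaMatrix, hp0, div_eq_iff hm, ← hh, Finset.mul_sum,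
      Finset.mul_sum, Finset.sum_mul, hX0]
    refine Finset.sum_congr rfl fun r hr => ?_
    have hrm : m = (m - r) + r := by have := Finset.mem_range.mp hr; omega
    have hcm : c ^ (m - r) * c ^ r = (π * Complex.I / 6) ^ m * h ^ m := by
      rw [← pow_add, ← hrm, hc, mul_pow]
    simp only [b, hp0, taylorCoeff, mul_pow, pow_add h m 6, sub_zero, one_pow, inv_one, mul_one,
      div_one]
    linear_combination (h ^ 6 * discriminant z * ((m.factorial : ℂ) / (r.factorial : ℂ)) *
      (Nat.choose (m + 11) (r + 11) : ℂ) * E2star z ^ (m - r) * calB r z) * hcm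
  · intro w hw
    have h1 := one_sub_ne_zero_of_mem_ball hw
    have hs : stroke 12 discriminant (sigmaMatrix z) =
        fun w => h ^ 6 * (pullback z discriminant w * ((1 - w) ^ 12)⁻¹) :=
      funext fun w => by rw [stroke_sigmaMatrix, div_eq_mul_inv]
    rw [hs]
    refine ((hderiv hmd 12 w hw).const_mul (h ^ 6)).congr_deriv ?_
    have : pullback z (normalizedDerivOfComplex discriminant) w =
      pullback z EisensteinSeries.E2 w * pullback z discriminant w :=
      normalizedDeriv_discriminant _
    rw [this]
    simp only [X]
    field_simp
    push_cast
    ring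
  · intro w hw
    have h1 := one_sub_ne_zero_of_mem_ball hw
    refine (((hderiv E2_mdifferentiable 2 w hw).const_mul c).add (hinv w hw 1)).congr_deriv ?_
    have : pullback z (normalizedDerivOfComplex EisensteinSeries.E2) w =
      (pullback z EisensteinSeries.E2 w ^ 2 - pullback z E₄ w) / 12 := normalizedDeriv_E2 _
    rw [this]
    simp only [X, e]
    field_simp
    push_cast
    ring
  · intro n w hw
    have h1 := one_sub_ne_zero_of_mem_ball hw
    refine ((hderiv (mdifferentiable_calB n) (2 * n) w hw).const_mul (c ^ n)).congr_deriv ?_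
    -- For n = 0 the truncated index n - 1 is harmless: its factor n is 0, and 𝓑₁ = 0 matches the
    -- derivative of a constant.
    rcases n with _ | n
    · simp [b, calB, pullback]
    · have hrec : pullback z (calB (n + 2)) w =
          12 * (pullback z (normalizedDerivOfComplex (calB (n + 1))) w -
            2 * (n + 1) * 12⁻¹ * pullback z EisensteinSeries.E2 w * pullback z (calB (n + 1)) w) -
          (n + 1) * (n + 12) * pullback z E₄ w * pullback z (calB n) w := by
        simp only [pullback, calB, serreDerivative_apply]
        push_cast
        ring
      simp only [b, X, e, hrec, Nat.add_sub_cancel, mul_add, pow_add, pow_mul]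
      push_cast
      field_simp
      ring
  · intro w _
    simp [b, calB, pullback]

end DeltaTaylor

end

/-- Each `𝓑_r` is (the function of) a modular form of weight `2 r` for `SL(2, ℤ)`, and the `m`-th
Fourier coefficient of `Δ` at an arbitrary point `z` is given by the stated formula. -/
theorem theorem4p1 :
    (∀ r : ℕ, ∃ g : ModularForm 𝒮ℒ ((2 * r : ℕ) : ℤ), (g : ℍ → ℂ) = DeltaTaylor.calB r) ∧
    (∀ (z : ℍ) (m : ℕ),
      DeltaTaylor.fourierCoeffAt 12 ModularForm.discriminant z m =
        ModularForm.discriminant z * ((π : ℂ) * Complex.I / 6) ^ m *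
          ((z : ℂ) - starRingEnd ℂ (z : ℂ)) ^ (m + 6) *
          ∑ r ∈ Finset.range (m + 1),
            (1 / (r.factorial : ℂ)) * (Nat.choose (m + 11) (r + 11) : ℂ) *
              DeltaTaylor.E2star z ^ (m - r) * DeltaTaylor.calB r z) := by
  exact ⟨DeltaTaylor.exists_modularForm_calB, DeltaTaylor.fourierCoeffAt_discriminant⟩
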